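/- A right loop is a set $S$ with a binary operation $\circ$ and a two-sided identity $1$ such that for all $a,b\in S$ the equation $X\circ a=b$ has a unique solution $X\in S$. For $y,z\in S$ let $f^S(y,z):S\to S$ be the bijection sending $x$ to the unique solution $X$ of $X\circ(y\circ z)=(x\circ y)\circ z$. The group torsion $G_S$ is the subgroup of $\mathrm{Sym}(S)$ generated by $\{f^S(y,z)\mid y,z\in S\}$. A congruence on $S$ is an equivalence relation on $S$ that is a sub right loop of $S\times S$ (i.e. closed under $\circ$ and under right division); for a congruence $R$, the quotient $S/R$ is again a right loop. For a set $X$, an equivalence relation $\delta$ on $X$ and $w\in X$, write $\delta_w$ for the $\delta$-class of $w$. Let $\beta,\gamma$ be congruences on $S$. One says that $\gamma$ centralizes $\beta$ if there is a congruence $\delta$ on the right loop $\beta\le S\times S$ such that 1. for $(x,y),(u,v)\in\beta$: $(x,y)\mathrel{\delta}(u,v)$ implies $x\mathrel{\gamma}u$; 2. for every $(x,y)\in\beta$, the map $\delta_{(x,y)}\to\gamma_x$, $(u,v)\mapsto u$, is a bijection; 3. for $(x,y)\in\gamma$: $(x,x)\mathrel{\delta}(y,y)$; 4. for $(x,y),(u,v)\in\beta$: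 $(x,y)\mathrel{\delta}(u,v)$ implies $(y,x)\mathrel{\delta}(v,u)$; 5. for $(x,y),(y,z),(u,v),(v,w)\in\beta$: $(x,y)\mathrel{\delta}(u,v)$ and $(y,z)\mathrel{\delta}(v,w)$ imply $(x,z)\mathrel{\delta}(u,w)$. A congruence is central if it is centralized by $S\times S$. There is a greatest central congruence $\zeta(S)$ on $S$, and the center $\mathcal Z(S)$ is the $\zeta(S)$-class of $1$. Let $\zeta_0$ be the equality relation on $S$, and let $\zeta_{i+1}$ be the preimage in $S$ of the congruence $\zeta(S/\zeta_i)$; let $\mathcal Z_i$ be the $\zeta_i$-class of $1$, so that $\mathcal Z_0=\{1\}$, $\mathcal Z_1=\mathcal Z(S)$ and $\mathcal Z_{i+1}/\mathcal Z_i=\mathcal Z(S/\mathcal Z_i)$, where $S/\mathcal Z_i=S/\zeta_i$. The right loop $S$ is nilpotent if $\mathcal Z_n=S$ for some $n\in\mathbb N$. **Corollary.** If $S$ is a nilpotent right loop, then its group torsion $G_S$ is a solvable group. -/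

import Mathlib

/-- A right loop: a set with a binary operation `*` and a two-sided identity `1` such that every
equation `X * a = b` has a unique solution `X`. -/
class RightLoop (S : Type*) extends MulOneClass S where
  existsUnique_mul_eq : ∀ a b : S, ∃! X : S, X * a = b

namespace RightLoop

section Basic

variable {S : Type*} [RightLoop S]

/-- `rdiv b a` is the unique solution `X` of `X * a = b`. -/
noncomputable def rdiv (b a : S) : S := (existsUnique_mul_eq a b).choose

theorem rdiv_mul (b a : S) : rdiv b a * a = b := (existsUnique_mul_eq a b).choose_spec.1

theorem mul_right_cancel' {x y a : S} (h : x * a = y * a) : x = y :=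
  (existsUnique_mul_eq a (y * a)).unique h rfl

theorem mul_rdiv (x a : S) : rdiv (x * a) a = x := mul_right_cancel' (rdiv_mul (x * a) a)

/-- The inner map `f(y, z)`, as a permutation of `S`: it sends `x` to the unique solution `X` of
`X * (y * z) = (x * y) * z`. -/
noncomputable def innerMap (y z : S) : Equiv.Perm S where
  toFun x := rdiv ((x * y) * z) (y * z)
  invFun x := rdiv (rdiv (x * (y * z)) z) y
  left_inv x := by simp only [rdiv_mul, mul_rdiv]
  right_inv x := by simp only [rdiv_mul, mul_rdiv]

variable (S) in
/-- The group torsion of `S`: the subgroup of the symmetric group on `S` generated by all the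
maps `f(y, z)`. -/
def groupTorsion : Subgroup (Equiv.Perm S) :=
  Subgroup.closure {g | ∃ y z : S, g = innerMap y z}

end Basic

/-- A congruence on a right loop: an equivalence relation on `S` whose graph is a sub right loop of
`S × S`, that is, closed under multiplication and under right division. -/
structure LoopCon (S : Type*) [RightLoop S] extends Con S where
  rdiv' : ∀ {w x y z : S}, r w x → r y z → r (rdiv w y) (rdiv x z)

namespace LoopCon

variable {S : Type*} [RightLoop S]

instance : CoeFun (LoopCon S) (fun _ => S → S → Prop) := ⟨fun R x y => R.toCon x y⟩

@[ext] theorem ext {R R' : LoopCon S} (h : ∀ x y, R x y ↔ R' x y) : R = R' := by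
  cases R; cases R'
  congr 1
  exact Con.ext h

theorem rdiv (R : LoopCon S) {w x y z : S} (h : R w x) (h' : R y z) :
    R (RightLoop.rdiv w y) (RightLoop.rdiv x z) := R.rdiv' h h'

/-- The equality congruence, whose identity class is `{1}`. -/
instance : Bot (LoopCon S) :=
  ⟨{ (⊥ : Con S) with
      rdiv' := by
        intro w x y z h h'
        have h1 : w = x := h
        have h2 : y = z := h'
        subst h1 h2
        exact (⊥ : Con S).refl _ }⟩

/-- The total congruence `S × S`. -/
instance : Top (LoopCon S) := ⟨{ (⊤ : Con S) with rdiv' := fun _ _ => trivial }⟩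

/-- Inclusion of congruences. -/
instance : PartialOrder (LoopCon S) where
  le R R' := ∀ x y, R x y → R' x y
  le_refl _ _ _ h := h
  le_trans _ _ _ h h' x y hxy := h' x y (h x y hxy)
  le_antisymm _ _ h h' := LoopCon.ext fun x y => ⟨h x y, h' x y⟩

/-- The quotient `S / R`. -/
abbrev Quot (R : LoopCon S) : Type _ := R.toCon.Quotient

/-- The quotient of a right loop by a congruence is a right loop. -/
instance (R : LoopCon S) : RightLoop R.Quot where
  existsUnique_mul_eq := by
    intro a b
    induction a, b using Con.induction_on₂ with
    | _ a b =>
    refine ⟨((RightLoop.rdiv b a : S) : R.toCon.Quotient), ?_, ?_⟩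
    · change ((RightLoop.rdiv b a : S) : R.toCon.Quotient) * (a : R.toCon.Quotient) = b
      rw [← Con.coe_mul, rdiv_mul]
    · intro Y hY
      induction Y using Con.induction_on with
      | _ y =>
      change (y : R.toCon.Quotient) * (a : R.toCon.Quotient) = b at hY
      rw [← Con.coe_mul, Con.eq] at hY
      have h := R.rdiv hY (R.toCon.refl a)
      rw [mul_rdiv] at h
      exact (Con.eq _).2 h

/-- The canonical projection `S → S / R`. -/
def proj (R : LoopCon S) (x : S) : R.Quot := (x : R.toCon.Quotient)

theorem proj_mul (R : LoopCon S) (x y : S) : R.proj (x * y) = R.proj x * R.proj y := rfl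

theorem proj_rdiv (R : LoopCon S) (x y : S) :
    R.proj (RightLoop.rdiv x y) = RightLoop.rdiv (R.proj x) (R.proj y) := by
  apply mul_right_cancel' (a := R.proj y)
  rw [rdiv_mul, ← proj_mul, rdiv_mul]

/-- The congruence on `S` corresponding to a congruence `Q` on `S / R`: the preimage of `Q`
under the projection. -/
def pullback (R : LoopCon S) (Q : LoopCon R.Quot) : LoopCon S where
  r x y := Q (R.proj x) (R.proj y)
  iseqv := ⟨fun _ => Q.toCon.refl _, fun h => Q.toCon.symm h, fun h h' => Q.toCon.trans h h'⟩
  mul' h h' := Q.toCon.mul h h'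
  rdiv' h h' := by
    simp only [proj_rdiv]
    exact Q.rdiv h h'

/-- A congruence `β`, regarded as a set of pairs. -/
abbrev Pairs (β : LoopCon S) : Type _ := {p : S × S // β p.1 p.2}

/-- `β` is a right loop under the componentwise operation. -/
instance (β : LoopCon S) : RightLoop β.Pairs where
  mul p q := ⟨p.1 * q.1, β.toCon.mul p.2 q.2⟩
  one := ⟨1, β.toCon.refl 1⟩
  one_mul p := Subtype.ext (one_mul p.1)
  mul_one p := Subtype.ext (mul_one p.1)
  existsUnique_mul_eq a b := by
    refine ⟨⟨(RightLoop.rdiv b.1.1 a.1.1, RightLoop.rdiv b.1.2 a.1.2), β.rdiv b.2 a.2⟩, ?_, ?_⟩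
    · exact Subtype.ext (Prod.ext (rdiv_mul _ _) (rdiv_mul _ _))
    · intro Y hY
      have h : Y.1 * a.1 = b.1 := congrArg Subtype.val hY
      refine Subtype.ext (Prod.ext ?_ ?_)
      · exact mul_right_cancel' (a := a.1.1) ((congrArg Prod.fst h).trans (rdiv_mul _ _).symm)
      · exact mul_right_cancel' (a := a.1.2) ((congrArg Prod.snd h).trans (rdiv_mul _ _).symm)

/-- The pair `(x, y)` as an element of `β`. -/
def pair (β : LoopCon S) {x y : S} (h : β x y) : β.Pairs := ⟨(x, y), h⟩

/-- `δ` (a congruence on `β`) is a centering congruence by means of which `γ` centralizes `β`. -/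
structure IsCentering (γ β : LoopCon S) (δ : LoopCon β.Pairs) : Prop where
  fst_rel : ∀ {x y u v : S} (h : β x y) (k : β u v), δ (β.pair h) (β.pair k) → γ x u
  bijOn_fst : ∀ {x y : S} (h : β x y),
    Set.BijOn (fun q : β.Pairs => q.1.1) {q | δ (β.pair h) q} {u | γ x u}
  diag : ∀ {x y : S}, γ x y → δ (β.pair (β.toCon.refl x)) (β.pair (β.toCon.refl y))
  swap : ∀ {x y u v : S} (h : β x y) (k : β u v), δ (β.pair h) (β.pair k) →
    δ (β.pair (β.toCon.symm h)) (β.pair (β.toCon.symm k))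
  comp : ∀ {x y z u v w : S} (h : β x y) (h' : β y z) (k : β u v) (k' : β v w),
    δ (β.pair h) (β.pair k) → δ (β.pair h') (β.pair k') →
      δ (β.pair (β.toCon.trans h h')) (β.pair (β.toCon.trans k k'))

/-- `γ` centralizes `β`. -/
def Centralizes (γ β : LoopCon S) : Prop := ∃ δ : LoopCon β.Pairs, IsCentering γ β δ

/-- A congruence is central if it is centralized by `S × S`. -/
def IsCentral (α : LoopCon S) : Prop := Centralizes ⊤ α

end LoopCon

section Center

variable {S : Type*} [RightLoop S]

/-- Elements `z` satisfying the identities below; used only to show that a greatest central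
congruence exists. -/
def AuxZ (z : S) : Prop := ∀ x y : S, z * (x * y) = (z * x) * y ∧ x * (z * y) = z * (x * y)

theorem AuxZ.comm {z : S} (hz : AuxZ z) (x : S) : x * z = z * x := by
  simpa using (hz x 1).2

theorem AuxZ.one : AuxZ (1 : S) := fun x y => by simp

theorem AuxZ.mul {z w : S} (hz : AuxZ z) (hw : AuxZ w) : AuxZ (z * w) := by
  intro x y
  constructor
  · rw [← (hz w (x * y)).1, (hw x y).1, (hz _ _).1, (hz w x).1]
  · rw [← (hz w y).1, ← (hz w (x * y)).1, (hz _ _).2, (hw _ _).2]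

theorem AuxZ.left_cancel {z : S} (hz : AuxZ z) {x y : S} (h : z * x = z * y) : x = y := by
  rw [← hz.comm, ← hz.comm] at h
  exact mul_right_cancel' h

theorem AuxZ.inv {z : S} (hz : AuxZ z) : ∃ w : S, AuxZ w ∧ w * z = 1 := by
  have h1 : rdiv 1 z * z = 1 := rdiv_mul 1 z
  have h2 : z * rdiv 1 z = 1 := by rw [← hz.comm, h1]
  refine ⟨rdiv 1 z, fun x y => ⟨?_, ?_⟩, h1⟩
  · apply hz.left_cancel
    rw [(hz _ _).1, h2, one_mul, (hz _ _).1, (hz _ _).1, h2, one_mul]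
  · apply hz.left_cancel
    rw [← (hz _ _).2, (hz _ y).1, h2, one_mul, (hz _ _).1, h2, one_mul]

theorem AuxZ.mul_mul {z w : S} (hz : AuxZ z) (hw : AuxZ w) (x y : S) :
    (z * x) * (w * y) = (z * w) * (x * y) := by
  rw [← (hz _ _).1, (hw _ _).2, (hz _ _).1]

theorem AuxZ.rdiv {z w v : S} (hz : AuxZ z) (hw : AuxZ w) (hv' : AuxZ v) (hv : v * w = 1)
    (x y : S) : rdiv (z * x) (w * y) = (v * z) * rdiv x y := by
  apply mul_right_cancel' (a := w * y)
  rw [rdiv_mul, (hv'.mul hz).mul_mul hw, rdiv_mul, ← (hv' _ _).1, hz.comm w |>.symm, (hv' _ _).1, hv,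
    one_mul]

/-- The congruence whose identity class consists of the elements satisfying `AuxZ`. -/
def auxCon (S : Type*) [RightLoop S] : LoopCon S where
  r x y := ∃ z : S, AuxZ z ∧ x = z * y
  iseqv := by
    refine ⟨fun x => ⟨1, AuxZ.one, by simp⟩, ?_, ?_⟩
    · rintro x y ⟨z, hz, rfl⟩
      obtain ⟨w, hw, h⟩ := hz.inv
      exact ⟨w, hw, by rw [(hw _ _).1, h, one_mul]⟩
    · rintro x y t ⟨z, hz, rfl⟩ ⟨w, hw, rfl⟩
      exact ⟨z * w, hz.mul hw, (hz _ _).1⟩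
  mul' := by
    rintro _ x _ y ⟨z, hz, rfl⟩ ⟨w, hw, rfl⟩
    exact ⟨z * w, hz.mul hw, hz.mul_mul hw x y⟩
  rdiv' := by
    rintro _ x _ y ⟨z, hz, rfl⟩ ⟨w, hw, rfl⟩
    obtain ⟨v, hv, h⟩ := hw.inv
    exact ⟨v * z, hv.mul hz, hz.rdiv hw hv h x y⟩

theorem LoopCon.pairs_rdiv (β : LoopCon S) (p q : β.Pairs) :
    (RightLoop.rdiv p q).1 = (RightLoop.rdiv p.1.1 q.1.1, RightLoop.rdiv p.1.2 q.1.2) := by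
  have h : (RightLoop.rdiv p q).1 * q.1 = p.1 := congrArg Subtype.val (rdiv_mul p q)
  refine Prod.ext ?_ ?_
  · exact mul_right_cancel' (a := q.1.1) ((congrArg Prod.fst h).trans (rdiv_mul _ _).symm)
  · exact mul_right_cancel' (a := q.1.2) ((congrArg Prod.snd h).trans (rdiv_mul _ _).symm)

/-- The centering congruence for `auxCon`. -/
def auxCentering (S : Type*) [RightLoop S] : LoopCon (auxCon S).Pairs where
  r p q := ∃ z : S, AuxZ z ∧ p.1.1 = z * p.1.2 ∧ q.1.1 = z * q.1.2
  iseqv := by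
    refine ⟨fun p => ?_, ?_, ?_⟩
    · obtain ⟨z, hz, h⟩ := p.2
      exact ⟨z, hz, h, h⟩
    · rintro p q ⟨z, hz, h, h'⟩
      exact ⟨z, hz, h', h⟩
    · rintro p q t ⟨z, hz, h, h'⟩ ⟨w, hw, k, k'⟩
      have hzw : z = w := mul_right_cancel' (h'.symm.trans k)
      exact ⟨z, hz, h, hzw ▸ k'⟩
  mul' := by
    rintro p q p' q' ⟨z, hz, h, h'⟩ ⟨w, hw, k, k'⟩
    refine ⟨z * w, hz.mul hw, ?_, ?_⟩
    · change p.1.1 * p'.1.1 = (z * w) * (p.1.2 * p'.1.2)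
      rw [h, k, hz.mul_mul hw]
    · change q.1.1 * q'.1.1 = (z * w) * (q.1.2 * q'.1.2)
      rw [h', k', hz.mul_mul hw]
  rdiv' := by
    rintro p q p' q' ⟨z, hz, h, h'⟩ ⟨w, hw, k, k'⟩
    obtain ⟨v, hv, e⟩ := hw.inv
    refine ⟨v * z, hv.mul hz, ?_, ?_⟩
    · rw [LoopCon.pairs_rdiv, h, k]
      exact hz.rdiv hw hv e _ _
    · rw [LoopCon.pairs_rdiv, h', k']
      exact hz.rdiv hw hv e _ _

theorem auxCon_isCentral (S : Type*) [RightLoop S] : (auxCon S).IsCentral := by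
  refine ⟨auxCentering S, fun _ _ _ => trivial, ?_, fun {x y} _ => ?_, ?_, ?_⟩
  · rintro x y ⟨z, hz, hx⟩
    have hx' : x = z * y := hx
    refine ⟨fun _ _ => trivial, ?_, ?_⟩
    · rintro ⟨⟨a, b⟩, hp⟩ ⟨w, hw, h, h'⟩ ⟨⟨c, d⟩, hq⟩ ⟨v, hv, k, k'⟩ (e : a = c)
      change x = w * y at h
      change x = v * y at k
      change a = w * b at h'
      change c = v * d at k'
      have : v = w := mul_right_cancel' (k.symm.trans h)
      subst this
      have hbd : b = d := hv.left_cancel (by rw [← h', ← k', e])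
      subst e hbd
      rfl
    · intro u _
      obtain ⟨w, hw, h⟩ := hz.inv
      have hu : u = z * (w * u) := by rw [(hz _ _).1, (hw.comm z).trans h, one_mul]
      exact ⟨⟨(u, w * u), ⟨z, hz, hu⟩⟩, ⟨z, hz, hx', hu⟩, rfl⟩
  · exact ⟨1, AuxZ.one, (one_mul x).symm, (one_mul y).symm⟩
  · rintro x y u v h k ⟨z, hz, e, e'⟩
    obtain ⟨w, hw, hwz⟩ := hz.inv
    change x = z * y at e
    change u = z * v at e'
    refine ⟨w, hw, ?_, ?_⟩
    · change y = w * x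
      rw [e, (hw _ _).1, hwz, one_mul]
    · change v = w * u
      rw [e', (hw _ _).1, hwz, one_mul]
  · rintro x y z u v w h h' k k' ⟨a, ha, e, e'⟩ ⟨b, hb, f, f'⟩
    change x = a * y at e
    change u = a * v at e'
    change y = b * z at f
    change v = b * w at f'
    refine ⟨a * b, ha.mul hb, ?_, ?_⟩
    · change x = (a * b) * z
      rw [e, f, (ha _ _).1]
    · change u = (a * b) * w
      rw [e', f', (ha _ _).1]

theorem LoopCon.IsCentral.le_auxCon {α : LoopCon S} (hα : α.IsCentral) : α ≤ auxCon S := by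
  obtain ⟨δ, hδ⟩ := hα
  have key : ∀ z : S, α z 1 → AuxZ z := by
    intro z hz
    -- two pairs in one class with the same first coordinate agree
    have uniq : ∀ {a b c : S} (h : α a b) (h' : α a c), δ (α.pair h) (α.pair h') → b = c := by
      intro a b c h h' hd
      have := (hδ.bijOn_fst h).injOn (δ.toCon.refl _ : α.pair h ∈ {q | δ (α.pair h) q})
        (show α.pair h' ∈ {q | δ (α.pair h) q} from hd) rfl
      exact congrArg (fun q : α.Pairs => q.1.2) this
    have uniq' : ∀ {a b c : S} (h : α b a) (h' : α c a), δ (α.pair h) (α.pair h') → b = c :=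
      fun h h' hd => uniq _ _ (hδ.swap h h' hd)
    have d : ∀ x : S, δ (α.pair (α.toCon.refl 1)) (α.pair (α.toCon.refl x)) :=
      fun x => hδ.diag trivial
    let p : α.Pairs := α.pair hz
    let e : S → α.Pairs := fun x => α.pair (α.toCon.refl x)
    have hd : ∀ x y, δ (e x) (e y) := fun x y => δ.toCon.trans (δ.toCon.symm (d x)) (d y)
    have hp : ∀ x, δ p (p * e x) := fun x => by
      have := δ.toCon.mul (δ.toCon.refl p) (d x)
      rwa [show α.pair (α.toCon.refl 1) = (1 : α.Pairs) from rfl, mul_one] at this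
    have hp' : ∀ x, δ p (e x * p) := fun x => by
      have := δ.toCon.mul (d x) (δ.toCon.refl p)
      rwa [show α.pair (α.toCon.refl 1) = (1 : α.Pairs) from rfl, one_mul] at this
    have h2 : ∀ x y, δ p (p * e x * e y) := fun x y => by
      have := δ.toCon.mul (hp x) (d y)
      rwa [show α.pair (α.toCon.refl 1) = (1 : α.Pairs) from rfl, mul_one] at this
    have h3 : ∀ x y, δ p (e x * (p * e y)) := fun x y => by
      have := δ.toCon.mul (d x) (hp y)
      rwa [show α.pair (α.toCon.refl 1) = (1 : α.Pairs) from rfl, one_mul] at this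
    have m : ∀ x, α (z * x) x := fun x => by
      simpa using α.toCon.mul hz (α.toCon.refl x)
    intro x y
    constructor
    · refine uniq' (a := x * y) (m (x * y)) (α.toCon.mul (m x) (α.toCon.refl y)) ?_
      refine δ.toCon.trans (y := p) (δ.toCon.symm ?_) ?_
      · have E : α.pair (m (x * y)) = p * e (x * y) :=
          Subtype.ext (congrArg (Prod.mk (z * (x * y))) (one_mul (x * y)).symm)
        rw [E]
        exact hp (x * y)
      · have E : α.pair (α.toCon.mul (m x) (α.toCon.refl y)) = p * e x * e y :=
          Subtype.ext (congrArg (fun t => (z * x * y, t * y)) (one_mul x).symm)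
        rw [E]
        exact h2 x y
    · refine uniq' (a := x * y) (α.toCon.mul (α.toCon.refl x) (m y)) (m (x * y)) ?_
      refine δ.toCon.trans (y := p) (δ.toCon.symm ?_) ?_
      · have E : α.pair (α.toCon.mul (α.toCon.refl x) (m y)) = e x * (p * e y) :=
          Subtype.ext (congrArg (fun t => (x * (z * y), x * t)) (one_mul y).symm)
        rw [E]
        exact h3 x y
      · have E : α.pair (m (x * y)) = p * e (x * y) :=
          Subtype.ext (congrArg (Prod.mk (z * (x * y))) (one_mul (x * y)).symm)
        rw [E]
        exact hp (x * y)
  intro x y h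
  refine ⟨RightLoop.rdiv x y, key _ ?_, (rdiv_mul x y).symm⟩
  have := α.rdiv h (α.toCon.refl y)
  rwa [show RightLoop.rdiv y y = 1 by simpa using mul_rdiv 1 y] at this

/-- Among the central congruences on `S` there is a greatest one. -/
theorem exists_isGreatest_central (S : Type*) [RightLoop S] :
    ∃ ζ : LoopCon S, IsGreatest {α : LoopCon S | α.IsCentral} ζ :=
  ⟨auxCon S, auxCon_isCentral S, fun _ hα => LoopCon.IsCentral.le_auxCon hα⟩

/-- The center congruence `ζ(S)`: the unique maximal (indeed greatest) central congruence. -/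
noncomputable def centerCon (S : Type*) [RightLoop S] : LoopCon S :=
  (exists_isGreatest_central S).choose

theorem isGreatest_centerCon (S : Type*) [RightLoop S] :
    IsGreatest {α : LoopCon S | α.IsCentral} (centerCon S) :=
  (exists_isGreatest_central S).choose_spec

end Center

/-- The congruences of the central series of `S`: `ζ₀` is equality, and `ζᵢ₊₁ / ζᵢ` is the center
congruence of `S / ζᵢ`. -/
noncomputable def centralSeriesCon (S : Type*) [RightLoop S] : ℕ → LoopCon S
  | 0 => ⊥
  | i + 1 => (centralSeriesCon S i).pullback (centerCon (centralSeriesCon S i).Quot)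

/-- The term `𝒵ᵢ` of the central series of `S`: the class of the identity under `ζᵢ`. Thus
`𝒵₀ = {1}`, and `𝒵ᵢ₊₁ / 𝒵ᵢ` is the center of `S / 𝒵ᵢ`. -/
def centralSeries (S : Type*) [RightLoop S] (i : ℕ) : Set S := {x | centralSeriesCon S i x 1}

/-- `S` is nilpotent if its central series `{1} = 𝒵₀ ≤ 𝒵₁ ≤ ⋯` reaches `S`. -/
def IsNilpotent (S : Type*) [RightLoop S] : Prop := ∃ n : ℕ, centralSeries S n = Set.univ

end RightLoop

namespace RightLoop

open scoped commutatorElement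

section

variable {S : Type*} [RightLoop S]

/-! Each generator of the group torsion is built from right translations and an inverse right
translation. These descend to every quotient `S / R` and commute there with left multiplication by
central elements. So `groupTorsion S` lies in the group `centralEquivariant S` of permutations with
this compatibility, and it is enough to show that this larger group is solvable. On a class of a
central congruence of `S / R`, points differ by central factors. Two equivariant permutations that
preserve all such classes therefore move a given point by central factors, and these factors
commute. Hence commutators act trivially one level further down (`commutator_trivialModulo_le`).
Descending the central series, the `n`-th derived subgroup fixes every point of `S`. -/

theorem AuxZ.mul_right_iff {z : S} (hz : AuxZ z) {a b c : S} :
    a * c = z * (b * c) ↔ a = z * b := by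
  rw [(hz b c).1]
  exact ⟨mul_right_cancel', fun h => h ▸ rfl⟩

theorem AuxZ.rdiv_iff {z : S} (hz : AuxZ z) {a b c : S} :
    RightLoop.rdiv a c = z * RightLoop.rdiv b c ↔ a = z * b := by
  rw [← hz.mul_right_iff (c := c), rdiv_mul, rdiv_mul]

variable (S) in
/-- The permutations of `S` that, modulo every congruence `R`, are compatible with left
multiplication by the central elements of `S / R`. -/
def centralEquivariant : Subgroup (Equiv.Perm S) where
  -- The equivalence, rather than one implication, gives closure under inverses. The case `z = 1`
  -- says that `g` induces a permutation of `S / R`.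
  carrier := {g | ∀ (R : LoopCon S) (z : R.Quot), AuxZ z → ∀ a b : S,
    R.proj (g a) = z * R.proj (g b) ↔ R.proj a = z * R.proj b}
  one_mem' := fun _ _ _ _ _ => Iff.rfl
  mul_mem' := fun hg hh R z hz a b => (hg R z hz _ _).trans (hh R z hz a b)
  inv_mem' := fun {g} hg R z hz a b => by
    simpa using (hg R z hz (g⁻¹ a) (g⁻¹ b)).symm

/-- The map is right multiplication by `y`, then by `z`, then right division by `y * z`; a central
left factor can be pulled through each of the three. -/
theorem innerMap_mem_centralEquivariant (y z : S) : innerMap y z ∈ centralEquivariant S := by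
  intro R w hw a b
  change R.proj (RightLoop.rdiv ((a * y) * z) (y * z)) =
    w * R.proj (RightLoop.rdiv ((b * y) * z) (y * z)) ↔ _
  rw [R.proj_rdiv, R.proj_rdiv, hw.rdiv_iff, R.proj_mul, R.proj_mul (b * y), hw.mul_right_iff,
    R.proj_mul, R.proj_mul b, hw.mul_right_iff]

theorem groupTorsion_le_centralEquivariant : groupTorsion S ≤ centralEquivariant S := by
  rw [groupTorsion, Subgroup.closure_le]
  rintro _ ⟨y, z, rfl⟩
  exact innerMap_mem_centralEquivariant y z

theorem proj_eq_iff (R : LoopCon S) {x y : S} : R.proj x = R.proj y ↔ R x y := Con.eq _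

/-- The members of `centralEquivariant S` that act trivially on `S / R`. -/
def trivialModulo (R : LoopCon S) : Subgroup (centralEquivariant S) where
  carrier := {g | ∀ x, R (g.1 x) x}
  one_mem' := fun x => R.toCon.refl x
  mul_mem' := fun {g h} hg hh x => R.toCon.trans (hg (h.1 x)) (hh x)
  inv_mem' := fun {g} hg x => by
    have h := hg (g.1⁻¹ x)
    have e : g.1 (g.1⁻¹ x) = x := g.1.apply_symm_apply x
    rw [e] at h
    exact R.toCon.symm h

/-- Modulo `R`, if `g` multiplies `y` by a central `c` and `h` multiplies it by a central `d`, then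
equivariance gives `g (h y) = d * (c * y)` and `h (g y) = c * (d * y)`, which agree. -/
theorem commutator_trivialModulo_le (R : LoopCon S) {Q : LoopCon R.Quot} (hQ : Q ≤ auxCon R.Quot) :
    ⁅trivialModulo (R.pullback Q), trivialModulo (R.pullback Q)⁆ ≤ trivialModulo R := by
  rw [Subgroup.commutator_le]
  intro g hg h hh x
  -- Evaluating the commutator at `h (g y)` removes the inverses: only `g (h y)` and `h (g y)` need
  -- comparing.
  obtain ⟨y, rfl⟩ : ∃ y, (h * g).1 y = x := (h * g).1.surjective x
  have key : R (g.1 (h.1 y)) (h.1 (g.1 y)) := by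
    obtain ⟨c, hc, hgc⟩ : auxCon R.Quot (R.proj (g.1 y)) (R.proj y) := hQ _ _ (hg y)
    obtain ⟨d, hd, hhd⟩ : auxCon R.Quot (R.proj (h.1 y)) (R.proj y) := hQ _ _ (hh y)
    refine (proj_eq_iff R).1 ?_
    rw [(g.2 R d hd _ _).2 hhd, (h.2 R c hc _ _).2 hgc, hgc, hhd,
      (hd _ _).1, (hc _ _).1, hc.comm]
  have e : (⁅g, h⁆ : centralEquivariant S).1 ((h * g).1 y) = g.1 (h.1 y) := by
    change (⁅g, h⁆ * (h * g)).1 y = _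
    rw [commutatorElement_def, show g * h * g⁻¹ * h⁻¹ * (h * g) = g * h by group]
    rfl
  rw [e]
  exact key

theorem isSolvable_centralEquivariant (hS : IsNilpotent S) :
    Group.IsSolvable (centralEquivariant S) := by
  obtain ⟨n, hn⟩ := hS
  have top : trivialModulo (centralSeriesCon S n) = ⊤ := by
    have h1 : ∀ x, centralSeriesCon S n x 1 := fun x => by
      have : x ∈ centralSeries S n := hn ▸ Set.mem_univ x
      exact this
    exact eq_top_iff.2 fun g _ x => LoopCon.toCon _ |>.trans (h1 _) (LoopCon.toCon _ |>.symm (h1 x))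
  -- Each derived step costs one level of the central series, counted down from `n`.
  have descend : ∀ k i, i + k = n →
      derivedSeries (centralEquivariant S) k ≤ trivialModulo (centralSeriesCon S i) := by
    intro k
    induction k with
    | zero => rintro i rfl; exact top ▸ le_top
    | succ k ih =>
      intro i hi
      exact (Subgroup.commutator_mono (ih (i + 1) (by omega)) (ih (i + 1) (by omega))).trans
        (commutator_trivialModulo_le _ (isGreatest_centerCon _).1.le_auxCon)
  refine ⟨n, eq_bot_iff.2 fun g hg => ?_⟩
  -- At level `0` the congruence is equality, so acting trivially modulo it means being the
  -- identity.
  exact Subtype.ext (Equiv.ext fun x => descend n 0 (zero_add n) hg x)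

end

end RightLoop

theorem mainTheorem5 (S : Type*) [RightLoop S] (hS : RightLoop.IsNilpotent S) :
    Group.IsSolvable (RightLoop.groupTorsion S) := by
  have := RightLoop.isSolvable_centralEquivariant hS
  exact Group.isSolvable_of_isSolvable_injective
    (Subgroup.inclusion_injective (RightLoop.groupTorsion_le_centralEquivariant (S := S)))
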